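/- Let $m \neq n$ be integers with $m, n \geq 2$, and let $$BS(1,m;1,n) = \langle a,b,c \mid aba^{-1}=b^m,\ aca^{-1}=c^n\rangle ,$$ that is, the amalgamated product of the Baumslag--Solitar groups $BS(1,m)=\langle a,b\rangle$ and $BS(1,n)=\langle a,c\rangle$ over $\langle a\rangle$. Let $\mathrm{Diff}^1_+([0,1])$ be the group of orientation-preserving $C^1$ diffeomorphisms of $[0,1]$, and define the support of $g \in \mathrm{Diff}^1_+([0,1])$ to be the closure in $[0,1]$ of $\{x : g(x)\neq x\}$. Let $\rho : BS(1,m;1,n) \to \mathrm{Diff}^1_+([0,1])$ be any group homomorphism, and put $g=\rho(b)$ and $h=\rho(c)$. Then the interiors of the supports of $g$ and $h$ are disjoint. In particular, $g$ and $h$ commute, and $\rho$ is not injective (the action is not faithful). -/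

import Mathlib

open Set

/-- The three generators `a`, `b`, `c`. -/
inductive BSGen : Type
  | a
  | b
  | c

/-- The relators of `⟨a, b, c ∣ a b a⁻¹ = b ^ m, a c a⁻¹ = c ^ n⟩`. -/
def bsRels (m n : ℕ) : Set (FreeGroup BSGen) :=
  {FreeGroup.of BSGen.a * FreeGroup.of BSGen.b * (FreeGroup.of BSGen.a)⁻¹ *
      (FreeGroup.of BSGen.b ^ m)⁻¹,
    FreeGroup.of BSGen.a * FreeGroup.of BSGen.c * (FreeGroup.of BSGen.a)⁻¹ *
      (FreeGroup.of BSGen.c ^ n)⁻¹}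

/-- The group `BS(1,m;1,n) = ⟨a, b, c ∣ a b a⁻¹ = b ^ m, a c a⁻¹ = c ^ n⟩`. -/
abbrev BS2 (m n : ℕ) : Type :=
  PresentedGroup (bsRels m n)

namespace BS2

/-- The generator `a`. -/
def a (m n : ℕ) : BS2 m n := PresentedGroup.of BSGen.a

/-- The generator `b`. -/
def b (m n : ℕ) : BS2 m n := PresentedGroup.of BSGen.b

/-- The generator `c`. -/
def c (m n : ℕ) : BS2 m n := PresentedGroup.of BSGen.c

end BS2

/-- A self-map of `[0,1]` is of class `C¹` on the closed interval (with one-sided derivatives at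
the endpoints). Only the values on `[0,1]` of the extension to `ℝ` matter. -/
def IsC1 (f : Icc (0 : ℝ) 1 → Icc (0 : ℝ) 1) : Prop :=
  ContDiffOn ℝ 1 (IccExtend (zero_le_one (α := ℝ)) fun x => (f x : ℝ)) (Icc 0 1)

theorem isC1_id : IsC1 id := by
  refine contDiffOn_id.congr fun x hx => ?_
  rw [IccExtend_of_mem _ _ hx]
  rfl

theorem IsC1.comp {f g : Icc (0 : ℝ) 1 → Icc (0 : ℝ) 1} (hf : IsC1 f) (hg : IsC1 g) :
    IsC1 (f ∘ g) := by
  have h : MapsTo (IccExtend (zero_le_one (α := ℝ)) fun x => (g x : ℝ)) (Icc 0 1) (Icc 0 1) := by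
    intro x hx
    rw [IccExtend_of_mem _ _ hx]
    exact (g ⟨x, hx⟩).2
  refine (ContDiffOn.comp hf hg h).congr fun x hx => ?_
  rw [Function.comp_apply, IccExtend_of_mem _ _ hx, IccExtend_of_mem _ _ hx,
    IccExtend_of_mem _ _ (g ⟨x, hx⟩).2]
  rfl

/-- The group `Diff¹₊([0,1])` of orientation-preserving `C¹` diffeomorphisms of `[0,1]`, with
composition as multiplication. -/
def DiffOnePlus : Subgroup (Icc (0 : ℝ) 1 ≃ₜ Icc (0 : ℝ) 1) where
  carrier := {f | StrictMono f ∧ IsC1 f ∧ IsC1 f.symm}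
  one_mem' := ⟨strictMono_id, isC1_id, isC1_id⟩
  mul_mem' := fun hf hg =>
    ⟨hf.1.comp hg.1, hf.2.1.comp hg.2.1, hg.2.2.comp hf.2.2⟩
  inv_mem' := fun {f} hf =>
    ⟨fun x y hxy => hf.1.lt_iff_lt.1 (by
      change f (f.symm x) < f (f.symm y)
      simpa using hxy), hf.2.2, hf.2.1⟩

/-- The support of a homeomorphism: the closure of the set of points that it moves. -/
def homeoSupport {X : Type*} [TopologicalSpace X] (g : X ≃ₜ X) : Set X :=
  closure {x | g x ≠ x}

namespace DiffOnePlus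

open Filter Topology

/-! Let f = ρ(a), so f g f⁻¹ = gᵐ and f h f⁻¹ = hⁿ. The core claim is that no point is moved by both
g and h (`smul_eq_or_smul_eq`); disjoint supports and commutation follow formally.

Let (u, v) be a component of the complement of Fix g. Then f fixes u and v (`smul_endpoints_eq`),
has a fixed point inside (`exists_fixed_of_rel`), and has derivative exactly m at every fixed point
inside (`D_eq_of_fixed`). For h the derivative is n. Suppose a component of g and one of h overlap.
If they share their left endpoint, the shorter one contains a fixed point of f with derivative both
m and n. Otherwise the left endpoint of one lies inside the other, so it repels, as do all fixed
points of f inside its own component; this is impossible by `D_left_endpoint_le_one`.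

Both the endpoint and the derivative statements weigh mᵏ intervals against a distortion exp(kε),
with ε small by C¹ regularity. If f moved u or v, the translates f⁻ʲ[u, v] would shrink, and on them
mᵏ adjacent intervals of length at least of order m^(-k/2) would have to fit in [0,1]. For the
derivative, the points f⁻ᵏ gⁱ p cut a fixed interval near v into mᵏ pieces of nearly equal length.
Hence the interval from p to f⁻ᵏ g p has length m^(-k+o(k)), while its rate of decay is 1 / Df(p).

Non-injectivity follows because b and c do not commute in the group, as seen in an action on the
line (`not_commute_b_c`). -/

instance : MulAction DiffOnePlus (Icc (0 : ℝ) 1) where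
  smul f x := (f : Icc (0 : ℝ) 1 ≃ₜ Icc (0 : ℝ) 1) x
  one_smul _ := rfl
  mul_smul _ _ _ := rfl

theorem strictMono_smul (f : DiffOnePlus) : StrictMono fun x : Icc (0 : ℝ) 1 => f • x := f.2.1

theorem smul_lt_smul_iff (f : DiffOnePlus) {x y : Icc (0 : ℝ) 1} : f • x < f • y ↔ x < y :=
  (strictMono_smul f).lt_iff_lt

theorem smul_le_smul_iff (f : DiffOnePlus) {x y : Icc (0 : ℝ) 1} : f • x ≤ f • y ↔ x ≤ y :=
  (strictMono_smul f).le_iff_le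

theorem continuous_smul (f : DiffOnePlus) : Continuous fun x : Icc (0 : ℝ) 1 => f • x :=
  f.1.continuous

/-! ### Derivatives, the chain rule and length distortion. -/

/-- The extension of a diffeomorphism of `[0,1]` to the real line that is constant on both sides. -/
noncomputable def extend (f : DiffOnePlus) : ℝ → ℝ :=
  IccExtend (zero_le_one (α := ℝ)) fun x => ((f • x : Icc (0 : ℝ) 1) : ℝ)

theorem extend_coe (f : DiffOnePlus) (x : Icc (0 : ℝ) 1) : extend f x = (f • x : Icc (0 : ℝ) 1) :=
  IccExtend_val _ _ x

theorem contDiffOn_extend (f : DiffOnePlus) : ContDiffOn ℝ 1 (extend f) (Icc 0 1) := f.2.2.1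

/-- The (one-sided at the endpoints) derivative of a diffeomorphism of `[0,1]`. -/
noncomputable def D (f : DiffOnePlus) (x : Icc (0 : ℝ) 1) : ℝ :=
  derivWithin (extend f) (Icc 0 1) x

theorem hasDerivWithinAt (f : DiffOnePlus) (x : Icc (0 : ℝ) 1) :
    HasDerivWithinAt (extend f) (D f x) (Icc 0 1) x :=
  ((contDiffOn_extend f).differentiableOn one_ne_zero x x.2).hasDerivWithinAt

theorem continuous_D (f : DiffOnePlus) : Continuous (D f) :=
  continuousOn_iff_continuous_domRestrict.1
    ((contDiffOn_extend f).continuousOn_derivWithin (uniqueDiffOn_Icc zero_lt_one) le_rfl)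

theorem D_one (x : Icc (0 : ℝ) 1) : D 1 x = 1 := by
  refine HasDerivWithinAt.derivWithin ?_ (uniqueDiffOn_Icc zero_lt_one x x.2)
  refine (hasDerivWithinAt_id (x : ℝ) _).congr (fun y hy => ?_) ?_
  · exact extend_coe 1 ⟨y, hy⟩
  · exact extend_coe 1 x

theorem D_mul (f g : DiffOnePlus) (x : Icc (0 : ℝ) 1) : D (f * g) x = D f (g • x) * D g x := by
  refine HasDerivWithinAt.derivWithin ?_ (uniqueDiffOn_Icc zero_lt_one x x.2)
  have hf := hasDerivWithinAt f (g • x)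
  rw [← extend_coe] at hf
  refine (hf.comp (x : ℝ) (hasDerivWithinAt g x) ?_).congr (fun y hy => ?_) ?_
  · intro y hy
    rw [show extend g y = _ from extend_coe g ⟨y, hy⟩]
    exact (g • (⟨y, hy⟩ : Icc (0 : ℝ) 1)).2
  · change _ = extend f (extend g y)
    rw [show extend g y = _ from extend_coe g ⟨y, hy⟩, extend_coe,
      show extend (f * g) y = _ from extend_coe _ ⟨y, hy⟩, mul_smul]
  · change _ = extend f (extend g x)
    rw [extend_coe, extend_coe, extend_coe, mul_smul]

theorem D_nonneg (f : DiffOnePlus) (x : Icc (0 : ℝ) 1) : 0 ≤ D f x := by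
  apply MonotoneOn.derivWithin_nonneg
  intro y hy z hz hyz
  rw [show extend f y = _ from extend_coe f ⟨y, hy⟩, show extend f z = _ from extend_coe f ⟨z, hz⟩]
  exact (smul_le_smul_iff f).2 hyz

theorem D_pos (f : DiffOnePlus) (x : Icc (0 : ℝ) 1) : 0 < D f x := by
  refine (D_nonneg f x).lt_of_ne' fun h => ?_
  have := D_mul f⁻¹ f x
  rw [inv_mul_cancel, D_one, h, mul_zero] at this
  exact one_ne_zero this

theorem D_pow_of_fixed {g : DiffOnePlus} {x : Icc (0 : ℝ) 1} (hx : g • x = x) (k : ℕ) :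
    D (g ^ k) x = D g x ^ k := by
  induction k with
  | zero => simp [D_one]
  | succ k ih => rw [pow_succ, D_mul, hx, ih, pow_succ]

/-- Mean value theorem for diffeomorphisms of `[0,1]`. -/
theorem exists_D_mul_eq (f : DiffOnePlus) {x y : Icc (0 : ℝ) 1} (h : x < y) :
    ∃ c ∈ Ioo x y, ((f • y : Icc (0 : ℝ) 1) : ℝ) - (f • x : Icc (0 : ℝ) 1) =
      D f c * ((y : ℝ) - x) := by
  have hxy : (x : ℝ) < y := h
  have hsub : Icc (x : ℝ) y ⊆ Icc 0 1 := Icc_subset_Icc x.2.1 y.2.2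
  obtain ⟨c, hc, hc'⟩ := exists_hasDerivAt_eq_slope (extend f) (derivWithin (extend f) (Icc 0 1)) hxy
    ((contDiffOn_extend f).continuousOn.mono hsub) fun z hz => by
      have hz' := hsub (Ioo_subset_Icc_self hz)
      refine (hasDerivWithinAt f ⟨z, hz'⟩).hasDerivAt (Icc_mem_nhds ?_ ?_)
      · exact x.2.1.trans_lt hz.1
      · exact hz.2.trans_le y.2.2
  refine ⟨⟨c, hsub (Ioo_subset_Icc_self hc)⟩, ⟨hc.1, hc.2⟩, ?_⟩
  rw [← extend_coe, ← extend_coe]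
  change _ = derivWithin (extend f) (Icc 0 1) c * _
  rw [hc', div_mul_cancel₀ _ (sub_pos.2 hxy).ne']

theorem continuous_log_D (f : DiffOnePlus) : Continuous fun x => Real.log (D f x) :=
  (continuous_D f).log fun x => (D_pos f x).ne'

/-- Multiplicative control of the length of an image from control of `log D`. -/
theorem length_bounds (f : DiffOnePlus) {x y : Icc (0 : ℝ) 1} (h : x ≤ y) {l e : ℝ}
    (hc : ∀ c ∈ Icc x y, |Real.log (D f c) - l| ≤ e) :
    ((f • y : Icc (0 : ℝ) 1) : ℝ) - (f • x : Icc (0 : ℝ) 1) ≤ Real.exp (l + e) * ((y : ℝ) - x) ∧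
    Real.exp (l - e) * ((y : ℝ) - x) ≤ ((f • y : Icc (0 : ℝ) 1) : ℝ) - (f • x : Icc (0 : ℝ) 1) := by
  rcases h.eq_or_lt with rfl | h
  · simp
  obtain ⟨c, hcm, hce⟩ := exists_D_mul_eq f h
  have hxy : 0 ≤ (y : ℝ) - x := sub_nonneg.2 h.le
  have := abs_le.1 (hc c (Ioo_subset_Icc_self hcm))
  rw [hce, ← Real.exp_log (D_pos f c)]
  constructor <;> gcongr <;> linarith

theorem exists_zero_between {F : Icc (0 : ℝ) 1 → ℝ} (hF : Continuous F) {x y : Icc (0 : ℝ) 1}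
    (h : x ≤ y) (h0 : F x * F y ≤ 0) : ∃ z ∈ Icc x y, F z = 0 := by
  rcases le_total (F x) 0 with h1 | h1
  · rcases le_or_gt 0 (F y) with h2 | h2
    · obtain ⟨z, hz, hz'⟩ := intermediate_value_Icc h hF.continuousOn ⟨h1, h2⟩
      exact ⟨z, hz, hz'⟩
    · exact ⟨x, left_mem_Icc.2 h, by nlinarith⟩
  · rcases le_or_gt (F y) 0 with h2 | h2
    · obtain ⟨z, hz, hz'⟩ := intermediate_value_Icc' h hF.continuousOn ⟨h2, h1⟩
      exact ⟨z, hz, hz'⟩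
    · exact ⟨x, left_mem_Icc.2 h, by nlinarith⟩

/-- The displacement `x ↦ f x - x`. -/
theorem continuous_displacement (f : DiffOnePlus) :
    Continuous fun x : Icc (0 : ℝ) 1 => ((f • x : Icc (0 : ℝ) 1) : ℝ) - x :=
  (continuous_subtype_val.comp (continuous_smul f)).sub continuous_subtype_val

/-! ### Fixed points, components and monotone orbits. -/

theorem smul_zero' (f : DiffOnePlus) : f • (⟨0, by simp⟩ : Icc (0 : ℝ) 1) = ⟨0, by simp⟩ := by
  apply le_antisymm
  · have := (smul_le_smul_iff f).2 (show (⟨0, by simp⟩ : Icc (0 : ℝ) 1) ≤ f⁻¹ • ⟨0, by simp⟩ from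
      (f⁻¹ • (⟨0, by simp⟩ : Icc (0 : ℝ) 1)).2.1)
    rwa [smul_inv_smul] at this
  · exact (f • (⟨0, by simp⟩ : Icc (0 : ℝ) 1)).2.1

theorem smul_one' (f : DiffOnePlus) : f • (⟨1, by simp⟩ : Icc (0 : ℝ) 1) = ⟨1, by simp⟩ := by
  apply le_antisymm
  · exact (f • (⟨1, by simp⟩ : Icc (0 : ℝ) 1)).2.2
  · have := (smul_le_smul_iff f).2 (show f⁻¹ • ⟨1, by simp⟩ ≤ (⟨1, by simp⟩ : Icc (0 : ℝ) 1) from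
      (f⁻¹ • (⟨1, by simp⟩ : Icc (0 : ℝ) 1)).2.2)
    rwa [smul_inv_smul] at this

theorem isClosed_fixed (g : DiffOnePlus) : IsClosed {x : Icc (0 : ℝ) 1 | g • x = x} :=
  isClosed_eq (continuous_smul g) continuous_id

/-- The component of the complement of the fixed point set containing a given moved point. -/
theorem exists_component {g : DiffOnePlus} {x : Icc (0 : ℝ) 1} (hx : g • x ≠ x) :
    ∃ u v, u < x ∧ x < v ∧ g • u = u ∧ g • v = v ∧ ∀ y ∈ Ioo u v, g • y ≠ y := by
  obtain ⟨u, ⟨hu, hux⟩, hu'⟩ := ((isClosed_fixed g).inter isClosed_Iic).isCompact.exists_isGreatest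
    (s := {y : Icc (0 : ℝ) 1 | g • y = y} ∩ Iic x) ⟨⟨0, by simp⟩, smul_zero' g, x.2.1⟩
  obtain ⟨v, ⟨hv, hvx⟩, hv'⟩ := ((isClosed_fixed g).inter isClosed_Ici).isCompact.exists_isLeast
    (s := {y : Icc (0 : ℝ) 1 | g • y = y} ∩ Ici x) ⟨⟨1, by simp⟩, smul_one' g, x.2.2⟩
  refine ⟨u, v, lt_of_le_of_ne hux fun h => hx (h ▸ hu), lt_of_le_of_ne hvx fun h => hx (h ▸ hv),
    hu, hv, fun y hy hgy => ?_⟩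
  rcases le_total y x with h | h
  · exact (hu' ⟨hgy, h⟩).not_gt hy.1
  · exact (hv' ⟨hgy, h⟩).not_gt hy.2

theorem lt_smul_of_component {g : DiffOnePlus} {u v x : Icc (0 : ℝ) 1}
    (h : ∀ y ∈ Ioo u v, g • y ≠ y) (hx : x ∈ Ioo u v) (hgx : x < g • x) :
    ∀ y ∈ Ioo u v, y < g • y := by
  intro y hy
  by_contra hlt
  have hx0 : 0 < ((g • x : Icc (0 : ℝ) 1) : ℝ) - x := sub_pos.2 hgx
  have hy0 : ((g • y : Icc (0 : ℝ) 1) : ℝ) - y ≤ 0 := sub_nonpos.2 (not_lt.1 hlt)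
  have key : ∃ z ∈ Ioo u v, ((g • z : Icc (0 : ℝ) 1) : ℝ) - z = 0 := by
    rcases le_total x y with hxy | hxy
    · obtain ⟨z, hz, hz'⟩ := exists_zero_between (continuous_displacement g) hxy
        (mul_nonpos_of_nonneg_of_nonpos hx0.le hy0)
      exact ⟨z, ⟨hx.1.trans_le hz.1, hz.2.trans_lt hy.2⟩, hz'⟩
    · obtain ⟨z, hz, hz'⟩ := exists_zero_between (continuous_displacement g) hxy
        (mul_nonpos_of_nonpos_of_nonneg hy0 hx0.le)
      exact ⟨z, ⟨hy.1.trans_le hz.1, hz.2.trans_lt hx.2⟩, hz'⟩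
  obtain ⟨z, hz, hz'⟩ := key
  exact h z hz (Subtype.ext (sub_eq_zero.1 hz'))

theorem smul_mem_Ioo {g : DiffOnePlus} {u v x : Icc (0 : ℝ) 1} (hu : g • u = u) (hv : g • v = v)
    (hx : x ∈ Ioo u v) : g • x ∈ Ioo u v := by
  constructor
  · rw [← hu]; exact (smul_lt_smul_iff g).2 hx.1
  · rw [← hv]; exact (smul_lt_smul_iff g).2 hx.2

theorem pow_smul_fixed {g : DiffOnePlus} {x : Icc (0 : ℝ) 1} (h : g • x = x) (k : ℕ) :
    g ^ k • x = x := by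
  induction k with
  | zero => simp
  | succ k ih => rw [pow_succ, mul_smul, h, ih]

theorem inv_smul_fixed {g : DiffOnePlus} {x : Icc (0 : ℝ) 1} (h : g • x = x) : g⁻¹ • x = x := by
  rw [inv_smul_eq_iff, h]

theorem le_pow_smul {g : DiffOnePlus} {x : Icc (0 : ℝ) 1} (h : x ≤ g • x) (k : ℕ) :
    x ≤ g ^ k • x := by
  induction k with
  | zero => simp
  | succ k ih =>
    rw [pow_succ, mul_smul]
    exact ih.trans ((smul_le_smul_iff (g ^ k)).2 h)

theorem lt_pow_smul {g : DiffOnePlus} {x : Icc (0 : ℝ) 1} (h : x < g • x) {k : ℕ} (hk : k ≠ 0) :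
    x < g ^ k • x := by
  obtain ⟨k, rfl⟩ := Nat.exists_eq_succ_of_ne_zero hk
  rw [pow_succ, mul_smul]
  exact (le_pow_smul h.le k).trans_lt ((smul_lt_smul_iff (g ^ k)).2 h)

theorem pow_smul_le_pow_smul {g : DiffOnePlus} {x : Icc (0 : ℝ) 1} (h : x ≤ g • x) {j k : ℕ}
    (hjk : j ≤ k) : g ^ j • x ≤ g ^ k • x := by
  obtain ⟨i, rfl⟩ := Nat.exists_eq_add_of_le hjk
  rw [pow_add, mul_smul]
  exact (smul_le_smul_iff (g ^ j)).2 (le_pow_smul h i)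

theorem smul_eq_of_pow_smul_eq {g : DiffOnePlus} {x : Icc (0 : ℝ) 1} {k : ℕ} (hk : k ≠ 0)
    (h : g ^ k • x = x) : g • x = x := by
  rcases lt_trichotomy x (g • x) with h1 | h1 | h1
  · exact absurd h (lt_pow_smul h1 hk).ne'
  · exact h1.symm
  · have h2 : x < g⁻¹ • x := by
      have := (smul_lt_smul_iff g⁻¹).2 h1
      rwa [inv_smul_smul] at this
    refine absurd ?_ (lt_pow_smul h2 hk).ne'
    rw [inv_pow, inv_smul_eq_iff, h]

/-- The orbit of a point moved to the right accumulates on the next fixed point. -/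
theorem exists_lt_pow_smul {g : DiffOnePlus} {u v x y : Icc (0 : ℝ) 1}
    (h : ∀ y ∈ Ioo u v, y < g • y) (hx : x ∈ Ioo u v) (hy : y < v) :
    ∃ k : ℕ, y < g ^ k • x := by
  by_contra! hle
  have hmono : Monotone fun k : ℕ => g ^ k • x :=
    fun j k hjk => pow_smul_le_pow_smul (h x hx).le hjk
  have hlim := tendsto_atTop_ciSup hmono ⟨y, by rintro _ ⟨k, rfl⟩; exact hle k⟩
  set L := ⨆ k : ℕ, g ^ k • x
  have hL : L ≤ y := le_of_tendsto' hlim hle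
  have hxL : x ≤ L := by simpa using hmono.ge_of_tendsto hlim 0
  have h1 : Tendsto (fun k : ℕ => g ^ (k + 1) • x) atTop (𝓝 (g • L)) := by
    simpa only [pow_succ', mul_smul, Function.comp_def] using
      ((continuous_smul g).tendsto L).comp hlim
  have h2 := tendsto_nhds_unique h1 (hlim.comp (tendsto_add_atTop_nat 1))
  exact (h L ⟨hx.1.trans_le hxL, hL.trans_lt hy⟩).ne' h2

/-! ### Algebra of the relation f g = gᵐ f. -/

section Relation

variable {f g : DiffOnePlus} {m : ℕ}

theorem mul_pow_of_rel (h : f * g = g ^ m * f) (i : ℕ) : f * g ^ i = g ^ (m * i) * f := by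
  induction i with
  | zero => simp
  | succ i ih => rw [pow_succ, ← mul_assoc, ih, mul_assoc, h, ← mul_assoc, ← pow_add, mul_add_one]

theorem pow_mul_pow_of_rel (h : f * g = g ^ m * f) (k i : ℕ) :
    f ^ k * g ^ i = g ^ (m ^ k * i) * f ^ k := by
  induction k generalizing i with
  | zero => simp
  | succ k ih =>
    rw [pow_succ, mul_assoc, mul_pow_of_rel h, ← mul_assoc, ih, mul_assoc, pow_succ, mul_assoc]

theorem inv_pow_mul_pow_of_rel (h : f * g = g ^ m * f) (k i : ℕ) :
    f⁻¹ ^ k * g ^ (m ^ k * i) = g ^ i * f⁻¹ ^ k := by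
  rw [inv_pow, inv_mul_eq_iff_eq_mul, ← mul_assoc, pow_mul_pow_of_rel h, mul_inv_cancel_right]

theorem inv_rel (h : f * g = g ^ m * f) : f * g⁻¹ = g⁻¹ ^ m * f := by
  rw [inv_pow, eq_inv_mul_iff_mul_eq, ← mul_assoc, ← h, mul_inv_cancel_right]

/-- gᵐ and g have the same fixed points, as g preserves order; hence f permutes Fix g and therefore
its complementary components. -/
theorem smul_fixed_iff_of_rel (hm : m ≠ 0) (h : f * g = g ^ m * f) {y : Icc (0 : ℝ) 1} :
    g • f • y = f • y ↔ g • y = y := by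
  constructor
  · intro hy
    have := pow_smul_fixed hy m
    rw [← mul_smul, ← h, mul_smul] at this
    exact smul_left_cancel f this
  · intro hy
    refine smul_eq_of_pow_smul_eq hm ?_
    rw [← mul_smul, ← h, mul_smul, hy]

theorem inv_pow_smul_fixed_of_rel (hm : m ≠ 0) (h : f * g = g ^ m * f) {y : Icc (0 : ℝ) 1}
    (hy : g • y = y) (k : ℕ) : g • f⁻¹ ^ k • y = f⁻¹ ^ k • y := by
  induction k with
  | zero => simpa using hy
  | succ k ih =>
    rw [pow_succ', mul_smul, ← smul_fixed_iff_of_rel hm h, smul_inv_smul, ih]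

end Relation

/-! ### Exponential distortion and invariance of components. -/

theorem pow_length_bounds (g : DiffOnePlus) {x y : Icc (0 : ℝ) 1} (hxy : x ≤ y) {e : ℝ} (k : ℕ)
    (hc : ∀ i < k, ∀ c ∈ Icc (g ^ i • x) (g ^ i • y), |Real.log (D g c)| ≤ e) :
    ((g ^ k • y : Icc (0 : ℝ) 1) : ℝ) - (g ^ k • x : Icc (0 : ℝ) 1) ≤
      Real.exp (k * e) * ((y : ℝ) - x) ∧
    Real.exp (-(k * e)) * ((y : ℝ) - x) ≤
      ((g ^ k • y : Icc (0 : ℝ) 1) : ℝ) - (g ^ k • x : Icc (0 : ℝ) 1) := by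
  induction k with
  | zero => simp
  | succ k ih =>
    have ih' := ih fun i hi => hc i (hi.trans k.lt_succ_self)
    have hk := length_bounds g ((smul_le_smul_iff (g ^ k)).2 hxy) (l := 0) (e := e)
      (by simpa using hc k k.lt_succ_self)
    rw [zero_add, zero_sub] at hk
    rw [pow_succ', mul_smul, mul_smul]
    constructor
    · refine hk.1.trans ((mul_le_mul_of_nonneg_left ih'.1 (Real.exp_pos _).le).trans_eq ?_)
      rw [← mul_assoc, ← Real.exp_add]
      push_cast; ring_nf
    · refine le_trans (Eq.le ?_) ((mul_le_mul_of_nonneg_left ih'.2 (Real.exp_pos _).le).trans hk.2)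
      rw [← mul_assoc, ← Real.exp_add]
      push_cast; ring_nf

theorem inv_pow_smul_succ (f : DiffOnePlus) (k : ℕ) (x : Icc (0 : ℝ) 1) :
    f • f⁻¹ ^ (k + 1) • x = f⁻¹ ^ k • x := by
  rw [pow_succ', mul_smul, smul_inv_smul]

/-- Lower bound for the lengths of the translates of an interval in a shrinking family of
intervals. -/
theorem translate_length_bound {f g : DiffOnePlus} {m : ℕ} (hm : m ≠ 0) (h : f * g = g ^ m * f)
    {u v : Icc (0 : ℝ) 1} (hu : g • u = u) (hv : g • v = v) {e : ℝ} (he : 0 ≤ e) {K : ℕ}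
    (hg : ∀ j ≥ K, ∀ c ∈ Icc (f⁻¹ ^ j • u) (f⁻¹ ^ j • v), |Real.log (D g c)| ≤ e)
    (hf : ∀ j ≥ K, ∃ l, ∀ c ∈ Icc (f⁻¹ ^ j • u) (f⁻¹ ^ j • v), |Real.log (D f c) - l| ≤ e)
    (k : ℕ) : ∀ j ≥ K, ∀ x y, f⁻¹ ^ j • u ≤ x → x ≤ y → y ≤ f⁻¹ ^ j • v → ∀ i < m ^ k,
      Real.exp (-(k * ((m + 1) * e))) * ((y : ℝ) - x) ≤
        ((g ^ i • y : Icc (0 : ℝ) 1) : ℝ) - (g ^ i • x : Icc (0 : ℝ) 1) := by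
  have hmaps : ∀ (j i : ℕ) (z), f⁻¹ ^ j • u ≤ z → f⁻¹ ^ j • u ≤ g ^ i • z := fun j i z hz => by
    rw [← pow_smul_fixed (inv_pow_smul_fixed_of_rel hm h hu j) i]
    exact (smul_le_smul_iff _).2 hz
  have hmaps' : ∀ (j i : ℕ) (z), z ≤ f⁻¹ ^ j • v → g ^ i • z ≤ f⁻¹ ^ j • v := fun j i z hz => by
    rw [← pow_smul_fixed (inv_pow_smul_fixed_of_rel hm h hv j) i]
    exact (smul_le_smul_iff _).2 hz
  induction k with
  | zero =>
    intro j _ x y _ _ _ i hi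
    obtain rfl : i = 0 := by simpa using hi
    simp
  | succ k ih =>
    intro j hj x y hx hxy hy i hi
    -- Factor gⁱ = g^(i % m) · f g^(i / m) f⁻¹ and apply the induction hypothesis one level deeper.
    -- The constant l cancels between f⁻¹ and f at a cost of 2e, and the at most m - 1 remaining
    -- factors g cost (m - 1)e: in total (m + 1)e per level.
    have hx' : f⁻¹ ^ (j + 1) • u ≤ f⁻¹ • x := by
      rw [pow_succ', mul_smul]; exact (smul_le_smul_iff _).2 hx
    have hy' : f⁻¹ • y ≤ f⁻¹ ^ (j + 1) • v := by
      rw [pow_succ', mul_smul]; exact (smul_le_smul_iff _).2 hy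
    have hxy' : f⁻¹ • x ≤ f⁻¹ • y := (smul_le_smul_iff _).2 hxy
    obtain ⟨l, hl⟩ := hf (j + 1) (hj.trans j.le_succ)
    have hi' : i / m < m ^ k := Nat.div_lt_of_lt_mul (by rwa [pow_succ'] at hi)
    have h1 := ih (j + 1) (hj.trans j.le_succ) _ _ hx' hxy' hy' (i / m) hi'
    have h2 := (length_bounds f hxy' fun c hc => hl c ⟨hx'.trans hc.1, hc.2.trans hy'⟩).1
    have h3 := (length_bounds f ((smul_le_smul_iff (g ^ (i / m))).2 hxy') fun c hc =>
      hl c ⟨(hmaps _ _ _ hx').trans hc.1, hc.2.trans (hmaps' _ _ _ hy')⟩).2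
    have key : ∀ z : Icc (0 : ℝ) 1, f • g ^ (i / m) • f⁻¹ • z = g ^ (m * (i / m)) • z := by
      intro z
      rw [← mul_smul, mul_pow_of_rel h, mul_smul, smul_inv_smul]
    have h4 := (pow_length_bounds g ((smul_le_smul_iff (g ^ (m * (i / m)))).2 hxy) (i % m)
      fun a _ c hc => hg j hj c
        ⟨(hmaps _ _ _ (hmaps _ _ _ hx)).trans hc.1,
          hc.2.trans (hmaps' _ _ _ (hmaps' _ _ _ hy))⟩).2
    rw [← mul_smul, ← mul_smul, ← pow_add, Nat.mod_add_div] at h4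
    rw [key, key] at h3
    rw [smul_inv_smul, smul_inv_smul] at h2
    refine le_trans ?_ h4
    have hr : ((i % m : ℕ) : ℝ) ≤ m - 1 := by
      have : i % m + 1 ≤ m := Nat.mod_lt _ (Nat.pos_of_ne_zero hm)
      have : ((i % m + 1 : ℕ) : ℝ) ≤ m := by exact_mod_cast this
      push_cast at this; linarith
    calc Real.exp (-((k + 1 : ℕ) * ((m + 1) * e))) * ((y : ℝ) - x)
        ≤ Real.exp (-((k + 1 : ℕ) * ((m + 1) * e))) * (Real.exp (l + e) *
            (((f⁻¹ • y : Icc (0 : ℝ) 1) : ℝ) - (f⁻¹ • x : Icc (0 : ℝ) 1))) := by gcongr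
      _ = Real.exp (-((m - 1) * e)) * (Real.exp (l - e) * (Real.exp (-(k * ((m + 1) * e))) *
            (((f⁻¹ • y : Icc (0 : ℝ) 1) : ℝ) - (f⁻¹ • x : Icc (0 : ℝ) 1)))) := by
          simp only [← mul_assoc, ← Real.exp_add]
          push_cast; ring_nf
      _ ≤ Real.exp (-((m - 1) * e)) * (((g ^ (m * (i / m)) • y : Icc (0 : ℝ) 1) : ℝ) -
            (g ^ (m * (i / m)) • x : Icc (0 : ℝ) 1)) := by
          gcongr
          exact le_trans (by gcongr) h3
      _ ≤ _ := by
          refine mul_le_mul_of_nonneg_right ?_ (sub_nonneg.2 ((smul_le_smul_iff _).2 hxy))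
          gcongr

/-- On short translates, log Df is nearly constant and log Dg is nearly 0, so the images gⁱ[y, g y]
with i < mᵏ shrink too slowly for all of them to fit in [0,1]. -/
theorem false_of_lengths_tendsto_zero {f g : DiffOnePlus} {m : ℕ} (hm : 2 ≤ m)
    (h : f * g = g ^ m * f) {u v : Icc (0 : ℝ) 1} (huv : u < v) (hu : g • u = u) (hv : g • v = v)
    (hpos : ∀ y ∈ Ioo u v, y < g • y)
    (hlim : Tendsto (fun j : ℕ => ((f⁻¹ ^ j • v : Icc (0 : ℝ) 1) : ℝ) - (f⁻¹ ^ j • u : Icc (0 : ℝ) 1))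
      atTop (𝓝 0)) : False := by
  have hm0 : m ≠ 0 := by omega
  have hlog : 0 < Real.log m := Real.log_pos (by exact_mod_cast hm)
  -- Chosen so that k levels lose a factor m^(k/2), against mᵏ disjoint images.
  set e : ℝ := Real.log m / (2 * (m + 1)) with he_def
  have he : 0 < e := by positivity
  have hme : (m + 1) * e = Real.log m / 2 := by rw [he_def]; field_simp
  have huniv : ∀ k : DiffOnePlus, ∃ δ > 0, ∀ x y : Icc (0 : ℝ) 1, dist x y < δ →
      |Real.log (D k x) - Real.log (D k y)| ≤ e := fun k => by
    obtain ⟨δ, hδ, hd⟩ := Metric.uniformContinuous_iff.1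
      (CompactSpace.uniformContinuous_of_continuous (continuous_log_D k)) e he
    exact ⟨δ, hδ, fun x y hxy => (hd hxy).le⟩
  obtain ⟨δ₁, hδ₁, hd₁⟩ := huniv f
  obtain ⟨δ₂, hδ₂, hd₂⟩ := huniv g
  obtain ⟨K, hK⟩ := eventually_atTop.1 (hlim.eventually_lt_const (lt_min hδ₁ hδ₂))
  have hdist : ∀ j ≥ K, ∀ c ∈ Icc (f⁻¹ ^ j • u) (f⁻¹ ^ j • v),
      ∀ c' ∈ Icc (f⁻¹ ^ j • u) (f⁻¹ ^ j • v), dist c c' < min δ₁ δ₂ := by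
    intro j hj c hc c' hc'
    refine lt_of_le_of_lt ?_ (hK j hj)
    rw [Subtype.dist_eq]
    exact Real.dist_le_of_mem_Icc ⟨hc.1, hc.2⟩ ⟨hc'.1, hc'.2⟩
  have hlt : ∀ j : ℕ, f⁻¹ ^ j • u < f⁻¹ ^ j • v := fun j => (smul_lt_smul_iff _).2 huv
  obtain ⟨x, hx⟩ := exists_between huv
  obtain ⟨y, hy⟩ : ∃ y, y = f⁻¹ ^ K • x := ⟨_, rfl⟩
  have hfy : f ^ K • y = x := by rw [hy, inv_pow, smul_inv_smul]
  -- fᴷ carries y to x and conjugates g to g^(mᴷ), which moves x to the right.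
  have hyg : y < g • y := by
    rw [← smul_lt_smul_iff (f ^ K), ← mul_smul _ g]
    have := pow_mul_pow_of_rel h K 1
    rw [pow_one, mul_one] at this
    rw [this, mul_smul, hfy]
    exact lt_pow_smul (hpos x hx) (pow_ne_zero _ hm0)
  have hbound := fun k => translate_length_bound hm0 h hu hv he.le (K := K)
    (fun j hj c hc => by
      -- g fixes both ends of the translate, so Dg = 1 somewhere inside it; uniform continuity
      -- controls log Dg on the rest.
      obtain ⟨c', hc', hc''⟩ := exists_D_mul_eq g (hlt j)
      rw [inv_pow_smul_fixed_of_rel hm0 h hu, inv_pow_smul_fixed_of_rel hm0 h hv, eq_comm,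
        mul_eq_right₀ (sub_pos.2 (show ((f⁻¹ ^ j • u : Icc (0 : ℝ) 1) : ℝ) <
          (f⁻¹ ^ j • v : Icc (0 : ℝ) 1) from hlt j)).ne'] at hc''
      have := hd₂ c c' ((hdist j hj c hc c' (Ioo_subset_Icc_self hc')).trans_le (min_le_right _ _))
      rwa [hc'', Real.log_one, sub_zero] at this)
    (fun j hj => ⟨Real.log (D f (f⁻¹ ^ j • u)), fun c hc => hd₁ _ _
      ((hdist j hj c hc _ (left_mem_Icc.2 (hlt j).le)).trans_le (min_le_left _ _))⟩)
    k K le_rfl y (g • y)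
    (by rw [hy]; exact (smul_le_smul_iff _).2 hx.1.le) hyg.le (by
      rw [← inv_pow_smul_fixed_of_rel hm0 h hv, smul_le_smul_iff, hy]
      exact (smul_le_smul_iff _).2 hx.2.le)
  have hd : 0 < ((g • y : Icc (0 : ℝ) 1) : ℝ) - y := sub_pos.2 hyg
  obtain ⟨k, hk⟩ := pow_unbounded_of_one_lt (1 / (((g • y : Icc (0 : ℝ) 1) : ℝ) - y))
    (Real.one_lt_exp_iff.2 (half_pos hlog))
  rw [div_lt_iff₀ hd] at hk
  have hsum := Finset.sum_range_sub (fun i => ((g ^ i • y : Icc (0 : ℝ) 1) : ℝ)) (m ^ k)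
  have hle := Finset.card_nsmul_le_sum (Finset.range (m ^ k))
    (fun i => ((g ^ (i + 1) • y : Icc (0 : ℝ) 1) : ℝ) - (g ^ i • y : Icc (0 : ℝ) 1))
    (Real.exp (-(k * ((m + 1) * e))) * (((g • y : Icc (0 : ℝ) 1) : ℝ) - y)) (fun i hi => by
      have := hbound k i (Finset.mem_range.1 hi)
      rwa [← mul_smul _ g, ← pow_succ] at this)
  rw [hsum, Finset.card_range, nsmul_eq_mul, hme, ← mul_assoc] at hle
  have hexp : ((m ^ k : ℕ) : ℝ) * Real.exp (-(k * (Real.log m / 2))) =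
      Real.exp (Real.log m / 2) ^ k := by
    rw [← Real.exp_nat_mul, Nat.cast_pow, ← Real.exp_log (show (0 : ℝ) < m by positivity),
      ← Real.exp_nat_mul, ← Real.exp_add, Real.log_exp]
    ring_nf
  rw [hexp] at hle
  have h1 := (g ^ m ^ k • y).2.2
  have h2 := (g ^ 0 • y).2.1
  linarith

/-- The conjugating element fixes the components of the support. -/
theorem smul_endpoints_eq {f g : DiffOnePlus} {m : ℕ} (hm : 2 ≤ m)
    (h : f * g = g ^ m * f) {u v : Icc (0 : ℝ) 1} (huv : u < v) (hu : g • u = u) (hv : g • v = v)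
    (hpos : ∀ y ∈ Ioo u v, y < g • y) : f • u = u ∧ f • v = v := by
  have hm0 : m ≠ 0 := by omega
  have hge : ∀ z, g • z = z → u < z → v ≤ z := fun z hz huz => by
    by_contra! hlt
    exact (hpos z ⟨huz, hlt⟩).ne' hz
  have hgf : ∀ z, g • z = z → g • f • z = f • z := fun z hz => (smul_fixed_iff_of_rel hm0 h).2 hz
  have hgf' : ∀ z, g • z = z → g • f⁻¹ • z = f⁻¹ • z := fun z hz => by
    simpa using inv_pow_smul_fixed_of_rel hm0 h hz 1
  have hlt : ∀ j : ℕ, f⁻¹ ^ j • u ≤ f⁻¹ ^ j • v := fun j => (smul_le_smul_iff _).2 huv.le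
  have hfu : f • u = u := by
    by_contra hne
    refine false_of_lengths_tendsto_zero hm h huv hu hv hpos ?_
    rcases lt_or_gt_of_ne hne with h1 | h1
    -- The translates f⁻ʲ[u, v] march to the right without overlapping, so both sequences of
    -- endpoints share one limit.
    · have h2 : v ≤ f⁻¹ • u := hge _ (hgf' u hu) (by
        rwa [← smul_lt_smul_iff f, smul_inv_smul])
      have h3 : ∀ j : ℕ, f⁻¹ ^ j • v ≤ f⁻¹ ^ (j + 1) • u := fun j => by
        rw [pow_succ, mul_smul]; exact (smul_le_smul_iff _).2 h2
      have hmono : Monotone fun j : ℕ => f⁻¹ ^ j • u :=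
        monotone_nat_of_le_succ fun j => (hlt j).trans (h3 j)
      have hl := tendsto_atTop_ciSup hmono (OrderTop.bddAbove _)
      have hl' := tendsto_of_tendsto_of_tendsto_of_le_of_le hl (hl.comp (tendsto_add_atTop_nat 1))
        hlt h3
      simpa using ((continuous_subtype_val.tendsto _).comp hl').sub
        ((continuous_subtype_val.tendsto _).comp hl)
    · have h2 : v ≤ f • u := hge _ (hgf u hu) h1
      have h3 : ∀ j : ℕ, f⁻¹ ^ (j + 1) • v ≤ f⁻¹ ^ j • u := fun j => by
        rw [pow_succ, mul_smul, smul_le_smul_iff, ← smul_le_smul_iff f, smul_inv_smul]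
        exact h2
      have hmono : Antitone fun j : ℕ => f⁻¹ ^ j • v :=
        antitone_nat_of_succ_le fun j => (h3 j).trans (hlt j)
      have hl := tendsto_atTop_ciInf hmono (OrderBot.bddBelow _)
      have hl' := tendsto_of_tendsto_of_tendsto_of_le_of_le (hl.comp (tendsto_add_atTop_nat 1)) hl
        h3 hlt
      simpa using ((continuous_subtype_val.tendsto _).comp hl).sub
        ((continuous_subtype_val.tendsto _).comp hl')
  refine ⟨hfu, le_antisymm ?_ ?_⟩
  · rw [← smul_le_smul_iff f⁻¹, inv_smul_smul]
    refine hge _ (hgf' v hv) ?_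
    rwa [← smul_lt_smul_iff f, smul_inv_smul, hfu]
  · refine hge _ (hgf v hv) ?_
    rw [← hfu]
    exact (smul_lt_smul_iff f).2 huv

/-! ### Fixed points of the conjugating element and their multipliers. -/

theorem exists_fixed_of_rel {f g : DiffOnePlus} {m : ℕ} (hm : 2 ≤ m)
    (h : f * g = g ^ m * f) {u v : Icc (0 : ℝ) 1} (huv : u < v) (hu : g • u = u) (hv : g • v = v)
    (hpos : ∀ y ∈ Ioo u v, y < g • y) (hfu : f • u = u) (hfv : f • v = v) :
    ∃ p ∈ Ioo u v, f • p = p := by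
  obtain ⟨x, hx⟩ := exists_between huv
  have hfx : f • x ∈ Ioo u v := smul_mem_Ioo hfu hfv hx
  obtain ⟨j, hj⟩ := exists_lt_pow_smul hpos hfx hx.2
  obtain ⟨k, hk⟩ := exists_lt_pow_smul hpos hx hfx.2
  -- f gʲ x = g^(mj) f x, and m ≥ 2 leaves a spare gʲ to push f x past x. Thus f moves gʲ x weakly
  -- right and, likewise, g⁻ᵏ x weakly left.
  have h1 : g ^ j • x ≤ f • g ^ j • x := by
    obtain ⟨m, rfl⟩ := Nat.exists_eq_add_of_le hm
    rw [← mul_smul, mul_pow_of_rel h, mul_smul,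
      show (2 + m) * j = j + (j + m * j) by ring, pow_add, mul_smul, smul_le_smul_iff]
    exact hj.le.trans (pow_smul_le_pow_smul (hpos _ hfx).le (Nat.le_add_right _ _))
  have h2 : f • (g ^ k)⁻¹ • x ≤ (g ^ k)⁻¹ • x := by
    obtain ⟨m, rfl⟩ := Nat.exists_eq_add_of_le hm
    rw [← smul_le_smul_iff (g ^ ((2 + m) * k)), ← mul_smul _ f, ← mul_pow_of_rel h, mul_smul,
      smul_inv_smul, show (2 + m) * k = (k + m * k) + k by ring, pow_add _ _ k, mul_smul,
      smul_inv_smul]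
    exact hk.le.trans (pow_smul_le_pow_smul (hpos _ hx).le (Nat.le_add_right _ _))
  have hle : (g ^ k)⁻¹ • x ≤ g ^ j • x := by
    rw [← smul_le_smul_iff (g ^ k), smul_inv_smul, ← mul_smul, ← pow_add]
    exact le_pow_smul (hpos x hx).le _
  obtain ⟨p, hp, hp'⟩ := exists_zero_between (continuous_displacement f) hle
    (mul_nonpos_of_nonpos_of_nonneg (sub_nonpos.2 h2) (sub_nonneg.2 h1))
  refine ⟨p, ⟨lt_of_lt_of_le ?_ hp.1, lt_of_le_of_lt hp.2 ?_⟩, Subtype.ext (sub_eq_zero.1 hp')⟩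
  · rw [← smul_lt_smul_iff (g ^ k), smul_inv_smul, pow_smul_fixed hu]; exact hx.1
  · exact (smul_mem_Ioo (pow_smul_fixed hu j) (pow_smul_fixed hv j) hx).2

/-- A fixed point to the left of which all nearby points are moved to the right is not
repelling. -/
theorem D_le_one_of_fixed {f : DiffOnePlus} {w q : Icc (0 : ℝ) 1} (hwq : w < q) (hq : f • q = q)
    (h : ∀ y ∈ Ico w q, y < f • y) : D f q ≤ 1 := by
  by_contra! hlt
  have hev := (continuous_D f).continuousAt.eventually_const_lt hlt
  obtain ⟨l, hl, hl'⟩ := exists_Ioc_subset_of_mem_nhds hev ⟨w, hwq⟩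
  set y := max l w
  have hy : y < q := max_lt hl hwq
  obtain ⟨c, hc, hc'⟩ := exists_D_mul_eq f hy
  have h1 : 1 < D f c := hl' ⟨(le_max_left _ _).trans_lt hc.1, hc.2.le⟩
  have h2 : (y : ℝ) < (f • y : Icc (0 : ℝ) 1) := h y ⟨le_max_right _ _, hy⟩
  have h3 : (y : ℝ) < q := hy
  rw [hq] at hc'
  nlinarith

/-- A fixed point followed by a fixed point, all subsequent ones being repelling, is not
repelling. -/
theorem D_left_endpoint_le_one {f : DiffOnePlus} {u p : Icc (0 : ℝ) 1} (hup : u < p)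
    (hu : f • u = u) (hp : f • p = p) (h : ∀ q, u < q → q ≤ p → f • q = q → 1 < D f q) :
    D f u ≤ 1 := by
  by_contra! hlt
  have hev := (continuous_D f).continuousAt.eventually_const_lt hlt
  obtain ⟨l, hl, hl'⟩ := exists_Ico_subset_of_mem_nhds hev ⟨p, hup⟩
  obtain ⟨w, hw⟩ := exists_between (lt_min hl hup)
  have hwl := hw.2.trans_le (min_le_left _ _)
  have hwp := hw.2.trans_le (min_le_right _ _)
  obtain ⟨c, hc, hc'⟩ := exists_D_mul_eq f hw.1
  have h1 : 1 < D f c := hl' ⟨hc.1.le, hc.2.trans hwl⟩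
  have hwf : w < f • w := by
    rw [hu] at hc'
    have : (u : ℝ) < w := hw.1
    change (w : ℝ) < (f • w : Icc (0 : ℝ) 1)
    nlinarith
  have hclosed : IsClosed ({y : Icc (0 : ℝ) 1 | f • y ≤ y} ∩ Icc w p) :=
    (isClosed_le (continuous_smul f) continuous_id).inter isClosed_Icc
  -- The first point after w that f does not move right is fixed and is approached by points moving
  -- towards it, so it cannot repel.
  obtain ⟨q, ⟨hq, hwq, hqp⟩, hq'⟩ := hclosed.isCompact.exists_isLeast ⟨p, hp.le, hwp.le, le_rfl⟩
  have hwq' : w < q := lt_of_le_of_ne hwq fun he => (he ▸ hq : f • w ≤ w).not_gt hwf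
  have hpos : ∀ y ∈ Ico w q, y < f • y := fun y hy => by
    by_contra! hle
    exact (hq' ⟨hle, hy.1, hy.2.le.trans hqp⟩).not_gt hy.2
  have hqf : f • q = q := by
    refine eq_of_le_of_not_lt hq fun hlt' => ?_
    obtain ⟨a, ha, ha'⟩ := exists_Ioc_subset_of_mem_nhds
      ((isOpen_lt (continuous_smul f) continuous_id).mem_nhds hlt') ⟨w, hwq'⟩
    obtain ⟨y, hy⟩ := exists_between (max_lt ha hwq')
    exact lt_asymm (ha' ⟨(le_max_left _ _).trans_lt hy.1, hy.2.le⟩)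
      (hpos y ⟨(le_max_right _ _).trans hy.1.le, hy.2⟩)
  exact (D_le_one_of_fixed hwq' hqf hpos).not_gt (h q (hw.1.trans hwq') hqp hqf)

/-- By the chain rule at a common fixed point, Dg = (Dg)ᵐ, so the positive number Dg has (m - 1)-st
power 1. -/
theorem D_eq_one_of_rel {f g : DiffOnePlus} {m : ℕ} (hm : 2 ≤ m) (h : f * g = g ^ m * f)
    {v : Icc (0 : ℝ) 1} (hf : f • v = v) (hg : g • v = v) : D g v = 1 := by
  have h1 := congrArg (fun k => D k v) h
  simp only [D_mul, hf, hg, D_pow_of_fixed hg] at h1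
  obtain ⟨m, rfl⟩ := Nat.exists_eq_add_of_le hm
  have h2 : D g v ^ (1 + m) = 1 := by
    apply mul_right_cancel₀ (mul_pos (D_pos g v) (D_pos f v)).ne'
    linear_combination -h1
  exact (pow_eq_one_iff_of_nonneg (D_nonneg g v) (by omega)).1 h2

/-! ### Grids f⁻ᵏ gⁱ p and the asymptotics of their mesh. -/

/-- The point `f⁻ᵏ gⁱ p`. -/
def gridPoint (f g : DiffOnePlus) (p : Icc (0 : ℝ) 1) (k i : ℕ) : Icc (0 : ℝ) 1 :=
  f⁻¹ ^ k • g ^ i • p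

/-- The distance between two consecutive grid points. -/
def gridLength (f g : DiffOnePlus) (p : Icc (0 : ℝ) 1) (k i : ℕ) : ℝ :=
  (gridPoint f g p k (i + 1) : ℝ) - gridPoint f g p k i

section Grid

variable {f g : DiffOnePlus} {m : ℕ} {p v : Icc (0 : ℝ) 1}

theorem smul_gridPoint_succ (k i : ℕ) :
    f • gridPoint f g p (k + 1) i = gridPoint f g p k i :=
  inv_pow_smul_succ f k _

/-- f⁻ᵏ g fᵏ is an mᵏ-th root of g; when f fixes p, level k therefore cuts each block [g^N p,
g^(N+1) p] into mᵏ pieces. -/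
theorem gridPoint_add (h : f * g = g ^ m * f) (k a i : ℕ) :
    gridPoint f g p k (m ^ k * a + i) = g ^ a • gridPoint f g p k i := by
  rw [gridPoint, pow_add, mul_smul, ← mul_smul, inv_pow_mul_pow_of_rel h, mul_smul, gridPoint]

theorem gridPoint_zero_right (hp : f • p = p) (k : ℕ) : gridPoint f g p k 0 = p := by
  rw [gridPoint, pow_zero, one_smul, pow_smul_fixed (inv_smul_fixed hp)]

theorem gridPoint_pow_mul (h : f * g = g ^ m * f) (hp : f • p = p) (k N : ℕ) :
    gridPoint f g p k (m ^ k * N) = g ^ N • p := by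
  rw [← add_zero (m ^ k * N), gridPoint_add h, gridPoint_zero_right hp]

theorem gridPoint_mono (hgp : p ≤ g • p) (k : ℕ) : Monotone (gridPoint f g p k) :=
  fun _ _ hij => (smul_le_smul_iff _).2 (pow_smul_le_pow_smul hgp hij)

theorem gridLength_pos (hgp : p < g • p) (k i : ℕ) : 0 < gridLength f g p k i := by
  refine sub_pos.2 ((smul_lt_smul_iff (f⁻¹ ^ k)).2 ?_)
  rw [pow_succ, mul_smul]
  exact (smul_lt_smul_iff _).2 hgp

theorem gridPoint_le (hfv : f • v = v) (hgv : g • v = v) (hpv : p ≤ v) (k i : ℕ) :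
    gridPoint f g p k i ≤ v := by
  rw [← pow_smul_fixed (inv_smul_fixed hfv) k, ← pow_smul_fixed hgv i]
  exact (smul_le_smul_iff _).2 ((smul_le_smul_iff _).2 hpv)

/-- Two consecutive grid intervals of the same block have comparable lengths. -/
theorem gridLength_le (hm : m ≠ 0) (h : f * g = g ^ m * f) (hp : f • p = p) (hfv : f • v = v)
    (hgv : g • v = v) (hpv : p ≤ v) (hgp : p < g • p) {w : Icc (0 : ℝ) 1} {e l : ℝ} {M : ℕ}
    (he : 0 ≤ e) (hw : w ≤ g ^ M • p)
    (hDf : ∀ c ∈ Icc w v, |Real.log (D f c) - l| ≤ e)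
    (hDg : ∀ c ∈ Icc w v, |Real.log (D g c)| ≤ e) (k : ℕ) :
    ∀ N ≥ M, ∀ r < m ^ k, ∀ r' < m ^ k, gridLength f g p k (m ^ k * N + r) ≤
      Real.exp (k * ((2 * m + 2) * e)) * gridLength f g p k (m ^ k * N + r') := by
  have hge : ∀ k i, m ^ k * M ≤ i → w ≤ gridPoint f g p k i := fun k i hi => by
    refine hw.trans ?_
    rw [← gridPoint_pow_mul h hp k M]
    exact gridPoint_mono hgp.le k hi
  have hle := gridPoint_le hfv hgv hpv
  induction k with
  | zero =>
    intro N _ r hr r' hr'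
    obtain rfl : r = 0 := by simpa using hr
    obtain rfl : r' = 0 := by simpa using hr'
    simp
  | succ k ih =>
    intro N hN
    have hmk : 0 < m ^ k := pow_pos (Nat.pos_of_ne_zero hm) k
    have hmN : M ≤ m * N := hN.trans (Nat.le_mul_of_pos_left N (Nat.pos_of_ne_zero hm))
    -- Block N of level k + 1 consists of the indices of the m level-k blocks starting at mN; a
    -- power gᵃ with a < m moves each of these back to block mN at a cost of at most me.
    have shift : ∀ r < m ^ (k + 1),
        gridLength f g p k (m ^ (k + 1) * N + r) ≤
          Real.exp (m * e) * gridLength f g p k (m ^ k * (m * N) + r % m ^ k) ∧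
        Real.exp (-(m * e)) * gridLength f g p k (m ^ k * (m * N) + r % m ^ k) ≤
          gridLength f g p k (m ^ (k + 1) * N + r) := by
      intro r hr
      have ha : r / m ^ k < m := Nat.div_lt_of_lt_mul (by rwa [pow_succ] at hr)
      have haR : ((r / m ^ k : ℕ) : ℝ) ≤ m := by exact_mod_cast ha.le
      have hdecomp : m ^ (k + 1) * N + r =
          m ^ k * (r / m ^ k) + (m ^ k * (m * N) + r % m ^ k) := by
        conv_lhs => rw [← Nat.div_add_mod r (m ^ k)]
        ring
      have hb := pow_length_bounds g
        (gridPoint_mono (f := f) hgp.le k (Nat.le_succ (m ^ k * (m * N) + r % m ^ k))) (e := e)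
        (r / m ^ k) fun i _ c hc => hDg c (by
          rw [← gridPoint_add h, ← gridPoint_add h] at hc
          refine ⟨(hge k _ ?_).trans hc.1, hc.2.trans (hle _ _)⟩
          exact (Nat.mul_le_mul_left (m ^ k) hmN).trans
            ((Nat.le_add_right _ _).trans (Nat.le_add_left _ _)))
      rw [← gridPoint_add h, ← gridPoint_add h, Nat.succ_eq_add_one, ← add_assoc, ← hdecomp] at hb
      have hpos := (gridLength_pos (f := f) hgp k (m ^ k * (m * N) + r % m ^ k)).le
      exact ⟨hb.1.trans (mul_le_mul_of_nonneg_right (by gcongr) hpos),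
        (mul_le_mul_of_nonneg_right (by gcongr) hpos).trans hb.2⟩
    -- f maps level k + 1 to level k. Comparing two pieces uses this twice, where l cancels, and
    -- `shift` twice: a cost of (2m + 2)e per level.
    have step : ∀ i, m ^ (k + 1) * N ≤ i →
        gridLength f g p k i ≤ Real.exp (l + e) * gridLength f g p (k + 1) i ∧
        Real.exp (l - e) * gridLength f g p (k + 1) i ≤ gridLength f g p k i := by
      intro i hi
      have hb := length_bounds f (gridPoint_mono (f := f) hgp.le (k + 1) i.le_succ)
        (l := l) (e := e) fun c hc => hDf c ⟨(hge (k + 1) _ ?_).trans hc.1, hc.2.trans (hle _ _)⟩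
      · rwa [smul_gridPoint_succ, smul_gridPoint_succ] at hb
      · exact (Nat.mul_le_mul_left _ hN).trans hi
    intro r hr r' hr'
    calc gridLength f g p (k + 1) (m ^ (k + 1) * N + r)
        = Real.exp (-(l - e)) *
            (Real.exp (l - e) * gridLength f g p (k + 1) (m ^ (k + 1) * N + r)) := by
          rw [← mul_assoc, ← Real.exp_add]; simp
      _ ≤ Real.exp (-(l - e)) * (Real.exp (m * e) * (Real.exp (k * ((2 * m + 2) * e)) *
            gridLength f g p k (m ^ k * (m * N) + r' % m ^ k))) := by
          refine mul_le_mul_of_nonneg_left ?_ (Real.exp_pos _).le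
          refine (step _ (Nat.le_add_right _ _)).2.trans ((shift r hr).1.trans ?_)
          gcongr
          exact ih _ hmN _ (Nat.mod_lt _ hmk) _ (Nat.mod_lt _ hmk)
      _ = Real.exp (-(l - e)) * (Real.exp (m * e) * (Real.exp (k * ((2 * m + 2) * e)) *
            (Real.exp (m * e) * (Real.exp (-(m * e)) *
              gridLength f g p k (m ^ k * (m * N) + r' % m ^ k))))) := by
          rw [← mul_assoc (Real.exp (m * e)) (Real.exp (-(m * e))), ← Real.exp_add]; simp
      _ ≤ Real.exp (-(l - e)) * (Real.exp (m * e) * (Real.exp (k * ((2 * m + 2) * e)) *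
            (Real.exp (m * e) * (Real.exp (l + e) *
              gridLength f g p (k + 1) (m ^ (k + 1) * N + r'))))) := by
          iterate 4 refine mul_le_mul_of_nonneg_left ?_ (Real.exp_pos _).le
          exact (shift r' hr').2.trans (step _ (Nat.le_add_right _ _)).1
      _ = _ := by
          simp only [← mul_assoc, ← Real.exp_add]
          push_cast; ring_nf

/-- Near v the mᵏ pieces of block M are comparable up to exp(kη) and add up to a length independent
of k. Transport by g^M, whose distortion is bounded, brings the estimate back to the first piece at
p. -/
theorem log_gridLength_bound (hm : m ≠ 0) (h : f * g = g ^ m * f) (hp : f • p = p)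
    (hfv : f • v = v) (hgv : g • v = v) (hpv : p < v) (hgp : p < g • p) (hDgv : D g v = 1)
    (hacc : ∀ y < v, ∃ N : ℕ, y < g ^ N • p) {η : ℝ} (hη : 0 < η) :
    ∃ C : ℝ, ∀ k : ℕ, |Real.log (gridLength f g p k 0) + k * Real.log m| ≤ k * η + C := by
  have hm' : (0 : ℝ) < m := by exact_mod_cast Nat.pos_of_ne_zero hm
  set e : ℝ := η / (2 * m + 2) with he_def
  have he : 0 < e := by positivity
  have hme : (2 * m + 2) * e = η := by rw [he_def]; field_simp
  have hnear : ∀ k : DiffOnePlus, ∃ a < v, Ioc a v ⊆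
      {c | |Real.log (D k c) - Real.log (D k v)| < e} := fun k => by
    refine exists_Ioc_subset_of_mem_nhds ?_ ⟨p, hpv⟩
    refine ((continuous_log_D k).sub continuous_const).abs.continuousAt.eventually_lt_const ?_
    simpa using he
  obtain ⟨a, hav, ha⟩ := hnear f
  obtain ⟨b, hbv, hb⟩ := hnear g
  obtain ⟨M, hM⟩ := hacc (max a b) (max_lt hav hbv)
  have hcmp := gridLength_le hm h hp hfv hgv hpv.le hgp (w := g ^ M • p) (e := e)
    (l := Real.log (D f v)) (M := M) he.le le_rfl
    (fun c hc => (ha ⟨((le_max_left _ _).trans_lt hM).trans_le hc.1, hc.2⟩).le)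
    (fun c hc => by
      have : |Real.log (D g c) - Real.log (D g v)| < e :=
        hb ⟨((le_max_right _ _).trans_lt hM).trans_le hc.1, hc.2⟩
      rw [hDgv, Real.log_one, sub_zero] at this
      exact this.le)
  obtain ⟨B, hB⟩ := isCompact_univ.exists_bound_of_continuousOn
    (continuous_log_D (g ^ M)).continuousOn
  set L := gridLength f g p 0 M with hL_def
  have hL : 0 < L := gridLength_pos hgp 0 M
  refine ⟨B + |Real.log L|, fun k => ?_⟩
  have hmk : 0 < m ^ k := pow_pos (Nat.pos_of_ne_zero hm) k
  have hsum : ∑ r ∈ Finset.range (m ^ k), gridLength f g p k (m ^ k * M + r) = L := by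
    have := Finset.sum_range_sub (fun r => (gridPoint f g p k (m ^ k * M + r) : ℝ)) (m ^ k)
    rw [← mul_add_one, gridPoint_pow_mul h hp, add_zero, gridPoint_pow_mul h hp] at this
    refine this.trans ?_
    rw [hL_def, gridLength, gridPoint, gridPoint, pow_zero, one_smul, one_smul]
  have hup := Finset.sum_le_card_nsmul (Finset.range (m ^ k))
    (fun r => gridLength f g p k (m ^ k * M + r)) _
    fun r hr => hcmp k M le_rfl r (Finset.mem_range.1 hr) 0 hmk
  have hlow := Finset.card_nsmul_le_sum (Finset.range (m ^ k))
    (fun r => gridLength f g p k (m ^ k * M + r))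
    (Real.exp (-(k * η)) * gridLength f g p k (m ^ k * M + 0)) fun r hr => by
      have := hcmp k M le_rfl 0 hmk r (Finset.mem_range.1 hr)
      rw [hme] at this
      rwa [Real.exp_neg, inv_mul_le_iff₀ (Real.exp_pos _)]
  rw [hsum, Finset.card_range, nsmul_eq_mul, add_zero] at hup hlow
  rw [hme] at hup
  have hd : 0 < gridLength f g p k 0 := gridLength_pos hgp k 0
  have hB' := length_bounds (g ^ M) (gridPoint_mono (f := f) hgp.le k zero_le_one) (l := 0) (e := B)
    fun c _ => by simpa using hB c (mem_univ c)
  rw [← gridPoint_add h, ← gridPoint_add h, add_zero, zero_add, zero_sub] at hB'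
  have h1 : L ≤ (m ^ k : ℕ) * (Real.exp (k * η) * (Real.exp B * gridLength f g p k 0)) :=
    hup.trans (by gcongr; exact hB'.1)
  have h2 : (m ^ k : ℕ) * (Real.exp (-(k * η)) * (Real.exp (-B) * gridLength f g p k 0)) ≤ L :=
    le_trans (by gcongr; exact hB'.2) hlow
  have hlog : ∀ s t : ℝ, Real.log ((m ^ k : ℕ) * (Real.exp s * (Real.exp t *
      gridLength f g p k 0))) = k * Real.log m + (s + (t + Real.log (gridLength f g p k 0))) := by
    intro s t
    rw [Real.log_mul (by positivity) (by positivity), Real.log_mul (by positivity) (by positivity),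
      Real.log_mul (by positivity) (by positivity), Real.log_exp, Real.log_exp, Nat.cast_pow,
      Real.log_pow]
  have h3 := Real.log_le_log hL h1
  have h4 := Real.log_le_log (by positivity) h2
  rw [hlog] at h3 h4
  have h5 := neg_abs_le (Real.log L)
  have h6 := le_abs_self (Real.log L)
  rw [abs_le]
  constructor <;> linarith

end Grid

/-- The multiplier of the conjugating element at a fixed point in a component of the support. -/
theorem D_eq_of_fixed {f g : DiffOnePlus} {m : ℕ} (hm : 2 ≤ m) (h : f * g = g ^ m * f)
    {u v p : Icc (0 : ℝ) 1} (hv : g • v = v) (hpos : ∀ y ∈ Ioo u v, y < g • y)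
    (hfv : f • v = v) (hpuv : p ∈ Ioo u v) (hp : f • p = p) : D f p = m := by
  have hgp := hpos p hpuv
  have hm1 : (1 : ℝ) < m := by exact_mod_cast hm
  have hbound := fun η (hη : (0 : ℝ) < η) => log_gridLength_bound (by omega) h hp hfv hv hpuv.2 hgp
    (D_eq_one_of_rel hm h hfv hv) (fun y hy => exists_lt_pow_smul hpos hpuv hy) hη
  set d : ℕ → ℝ := fun k => gridLength f g p k 0 with hd_def
  have hd : ∀ k, 0 < d k := fun k => gridLength_pos hgp k 0
  have hlim : Tendsto (fun k : ℕ => (k : ℝ)⁻¹ * Real.log (d k)) atTop (𝓝 (-Real.log m)) := by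
    rw [Metric.tendsto_nhds]
    intro ε hε
    obtain ⟨C, hC⟩ := hbound (ε / 2) (half_pos hε)
    filter_upwards [eventually_gt_atTop 0,
      tendsto_natCast_atTop_atTop.eventually_gt_atTop (C / (ε / 2))] with k hk hk'
    have hkR : (0 : ℝ) < k := by exact_mod_cast hk
    rw [div_lt_iff₀ (half_pos hε)] at hk'
    rw [Real.dist_eq, sub_neg_eq_add,
      show (k : ℝ)⁻¹ * Real.log (d k) + Real.log m =
        (k : ℝ)⁻¹ * (Real.log (d k) + k * Real.log m) by field_simp,
      abs_mul, abs_of_pos (inv_pos.2 hkR), inv_mul_lt_iff₀ hkR]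
    refine (hC k).trans_lt ?_
    linarith
  have hbot : Tendsto (fun k => Real.log (d k)) atTop atBot := by
    refine (hlim.neg_mul_atTop (neg_lt_zero.2 (Real.log_pos hm1))
      tendsto_natCast_atTop_atTop).congr' ?_
    filter_upwards [eventually_gt_atTop 0] with k hk
    have hkR : (k : ℝ) ≠ 0 := by exact_mod_cast hk.ne'
    field_simp
  have hzero : Tendsto d atTop (𝓝 0) :=
    (Real.tendsto_exp_atBot.comp hbot).congr fun k => Real.exp_log (hd k)
  have hstep : ∀ k, ∃ c : Icc (0 : ℝ) 1, |(c : ℝ) - p| ≤ d (k + 1) ∧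
      Real.log (d (k + 1)) - Real.log (d k) = -Real.log (D f c) := by
    intro k
    obtain ⟨c, hc, hc'⟩ := exists_D_mul_eq f
      (show gridPoint f g p (k + 1) 0 < gridPoint f g p (k + 1) (0 + 1) from
        Subtype.coe_lt_coe.1 (sub_pos.1 (hd (k + 1))))
    rw [smul_gridPoint_succ, smul_gridPoint_succ] at hc'
    change d k = D f c * d (k + 1) at hc'
    rw [zero_add, gridPoint_zero_right hp] at hc
    refine ⟨c, ?_, ?_⟩
    · have h1 : (p : ℝ) < c := hc.1
      have h2 : (c : ℝ) < gridPoint f g p (k + 1) 1 := hc.2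
      rw [abs_of_pos (sub_pos.2 h1), hd_def]
      simp only [gridLength, gridPoint_zero_right hp]
      linarith
    · rw [hc', Real.log_mul (D_pos f c).ne' (hd _).ne']
      ring
  choose c hc hc' using hstep
  have hclim : Tendsto c atTop (𝓝 p) := by
    rw [tendsto_subtype_rng, tendsto_iff_dist_tendsto_zero]
    exact squeeze_zero (fun _ => dist_nonneg) hc (hzero.comp (tendsto_add_atTop_nat 1))
  have hces : Tendsto (fun k => Real.log (d (k + 1)) - Real.log (d k)) atTop
      (𝓝 (-Real.log (D f p))) := by
    simp only [hc']
    exact (((continuous_log_D f).tendsto p).comp hclim).neg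
  -- The increments of log dₖ tend to -log Df(p), hence so does (log dₖ - log d₀) / k; comparison
  -- with the limit -log m gives the multiplier.
  have hces' := hces.cesaro
  simp only [Finset.sum_range_sub fun k => Real.log (d k)] at hces'
  have h0 : Tendsto (fun k : ℕ => (k : ℝ)⁻¹ * Real.log (d 0)) atTop (𝓝 0) := by
    simpa using tendsto_inv_atTop_nhds_zero_nat.mul_const (Real.log (d 0))
  have huniq := tendsto_nhds_unique (hlim.sub h0) (hces'.congr fun k => mul_sub _ _ _)
  rw [sub_zero, neg_inj] at huniq
  exact (Real.log_injOn_pos (show (0 : ℝ) < m by linarith) (D_pos f p) huniq).symm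

/-- Local structure of an action of a solvable Baumslag-Solitar group near a point of the support
of the normal generator. -/
theorem exists_interval_of_rel {f g : DiffOnePlus} {m : ℕ} (hm : 2 ≤ m) (h : f * g = g ^ m * f)
    {x : Icc (0 : ℝ) 1} (hx : g • x ≠ x) :
    ∃ u v, u < x ∧ x < v ∧ f • u = u ∧ f • v = v ∧ (∃ p ∈ Ioo u v, f • p = p) ∧
      ∀ p ∈ Ioo u v, f • p = p → D f p = m := by
  -- g⁻¹ satisfies the same relation, and the conclusion does not mention g.
  wlog hgx : x < g • x generalizing g
  · refine this (inv_rel h) (fun h' => hx ?_) ?_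
    · rw [← h', smul_inv_smul, h']
    · rw [← smul_lt_smul_iff g, smul_inv_smul]
      exact lt_of_le_of_ne (not_lt.1 hgx) hx
  obtain ⟨u, v, hux, hxv, hu, hv, hne⟩ := exists_component hx
  have hpos := lt_smul_of_component hne ⟨hux, hxv⟩ hgx
  obtain ⟨hfu, hfv⟩ := smul_endpoints_eq hm h (hux.trans hxv) hu hv hpos
  exact ⟨u, v, hux, hxv, hfu, hfv, exists_fixed_of_rel hm h (hux.trans hxv) hu hv hpos hfu hfv,
    fun p hp hfp => D_eq_of_fixed hm h hv hpos hfv hp hfp⟩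

theorem smul_eq_or_smul_eq {f g k : DiffOnePlus} {m n : ℕ} (hm : 2 ≤ m) (hn : 2 ≤ n)
    (hmn : m ≠ n) (hg : f * g = g ^ m * f) (hk : f * k = k ^ n * f) (x : Icc (0 : ℝ) 1) :
    g • x = x ∨ k • x = x := by
  by_contra! hx
  obtain ⟨u, v, hux, hxv, hu, hv, ⟨p, hp, hfp⟩, hD⟩ := exists_interval_of_rel hm hg hx.1
  obtain ⟨u', v', hux', hxv', hu', hv', ⟨p', hp', hfp'⟩, hD'⟩ := exists_interval_of_rel hn hk hx.2
  have hm1 : (1 : ℝ) < m := by exact_mod_cast hm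
  have hn1 : (1 : ℝ) < n := by exact_mod_cast hn
  have hmn' : (m : ℝ) ≠ n := by exact_mod_cast hmn
  rcases lt_trichotomy u u' with h1 | h1 | h1
  -- Here u' lies inside (u, v), so it has multiplier m > 1, while the fixed points of f in (u', p']
  -- have multiplier n > 1.
  · refine (D_left_endpoint_le_one hp'.1 hu' hfp' fun q hq hq' hfq => ?_).not_gt
      ((hD u' ⟨h1, hux'.trans hxv⟩ hu').symm ▸ hm1)
    rwa [hD' q ⟨hq, hq'.trans_lt hp'.2⟩ hfq]
  · subst h1
    rcases le_total v v' with h2 | h2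
    · exact hmn' ((hD p hp hfp).symm.trans (hD' p ⟨hp.1, hp.2.trans_le h2⟩ hfp))
    · exact hmn' ((hD p' ⟨hp'.1, hp'.2.trans_le h2⟩ hfp').symm.trans (hD' p' hp' hfp'))
  · refine (D_left_endpoint_le_one hp.1 hu hfp fun q hq hq' hfq => ?_).not_gt
      ((hD' u ⟨h1, hux.trans hxv'⟩ hu).symm ▸ hn1)
    rwa [hD q ⟨hq, hq'.trans_lt hp.2⟩ hfq]

end DiffOnePlus

/-- Diffeomorphisms of the interval with disjoint sets of moved points commute. -/
theorem DiffOnePlus.commute_of_smul_eq_or {g k : DiffOnePlus}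
    (h : ∀ x : Icc (0 : ℝ) 1, g • x = x ∨ k • x = x) : Commute g k := by
  refine Subtype.ext (Homeomorph.ext fun x => ?_)
  change (g * k) • x = (k * g) • x
  rw [mul_smul, mul_smul]
  rcases h x with hx | hx
  · rw [hx]
    rcases h (k • x) with h' | h'
    · exact h'
    · rw [smul_left_cancel k h', hx]
  · rw [hx]
    rcases h (g • x) with h' | h'
    · rw [smul_left_cancel g h', hx]
    · exact h'.symm

/-- The open set V misses closure U; the open set interior (closure U) then misses closure V. -/
theorem disjoint_interior_closure {X : Type*} [TopologicalSpace X] {U V : Set X} (hV : IsOpen V)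
    (h : Disjoint U V) : Disjoint (interior (closure U)) (interior (closure V)) :=
  (((h.closure_left hV).mono_left interior_subset).closure_right isOpen_interior).mono_right
    interior_subset

/-! ### Noncommutation of b and c in the abstract group. -/

namespace BS2

theorem a_mul_b (m n : ℕ) : a m n * b m n = b m n ^ m * a m n := by
  have h : (PresentedGroup.mk (bsRels m n)) (FreeGroup.of BSGen.a * FreeGroup.of BSGen.b *
      (FreeGroup.of BSGen.a)⁻¹ * (FreeGroup.of BSGen.b ^ m)⁻¹) = 1 :=
    PresentedGroup.one_of_mem (Or.inl rfl)
  rw [map_mul, map_mul, map_mul, map_inv, map_inv, map_pow, mul_inv_eq_one,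
    mul_inv_eq_iff_eq_mul] at h
  exact h

theorem a_mul_c (m n : ℕ) : a m n * c m n = c m n ^ n * a m n := by
  have h : (PresentedGroup.mk (bsRels m n)) (FreeGroup.of BSGen.a * FreeGroup.of BSGen.c *
      (FreeGroup.of BSGen.a)⁻¹ * (FreeGroup.of BSGen.c ^ n)⁻¹) = 1 :=
    PresentedGroup.one_of_mem (Or.inr rfl)
  rw [map_mul, map_mul, map_mul, map_inv, map_inv, map_pow, mul_inv_eq_one,
    mul_inv_eq_iff_eq_mul] at h
  exact h

/-- The homomorphism to a group determined by three elements satisfying the relations. -/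
def lift {G : Type*} [Group G] {m n : ℕ} (A B C : G) (hB : A * B = B ^ m * A)
    (hC : A * C = C ^ n * A) : BS2 m n →* G :=
  PresentedGroup.toGroup (f := fun s => BSGen.casesOn s A B C) (by
    rintro r (rfl | rfl)
    · simp [hB]
    · simp [hC])

/-- The odd extension of `x ↦ x ^ s`. -/
noncomputable def signedPow (s x : ℝ) : ℝ := SignType.sign x * |x| ^ s

theorem signedPow_of_pos (s : ℝ) {x : ℝ} (hx : 0 < x) : signedPow s x = x ^ s := by
  simp [signedPow, sign_pos hx, abs_of_pos hx]

theorem signedPow_neg (s x : ℝ) : signedPow s (-x) = -signedPow s x := by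
  simp [signedPow, Left.sign_neg]

theorem signedPow_zero (s : ℝ) : signedPow s 0 = 0 := by simp [signedPow]

theorem signedPow_signedPow {s t : ℝ} (h : s * t = 1) (x : ℝ) :
    signedPow t (signedPow s x) = x := by
  have pos : ∀ y : ℝ, 0 < y → signedPow t (signedPow s y) = y := fun y hy => by
    rw [signedPow_of_pos s hy, signedPow_of_pos t (Real.rpow_pos_of_pos hy s),
      ← Real.rpow_mul hy.le, h, Real.rpow_one]
  rcases lt_trichotomy x 0 with hx | rfl | hx
  · have := pos (-x) (neg_pos.2 hx)
    rwa [signedPow_neg, signedPow_neg, neg_inj] at this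
  · rw [signedPow_zero, signedPow_zero]
  · exact pos x hx

theorem signedPow_mul (s : ℝ) {y : ℝ} (hy : 0 < y) (x : ℝ) :
    signedPow s (y * x) = y ^ s * signedPow s x := by
  have pos : ∀ z : ℝ, 0 < z → signedPow s (y * z) = y ^ s * signedPow s z := fun z hz => by
    rw [signedPow_of_pos s hz, signedPow_of_pos s (mul_pos hy hz), Real.mul_rpow hy.le hz.le]
  rcases lt_trichotomy x 0 with hx | rfl | hx
  · have := pos (-x) (neg_pos.2 hx)
    rwa [mul_neg, signedPow_neg, signedPow_neg, mul_neg, neg_inj] at this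
  · rw [mul_zero, signedPow_zero, mul_zero]
  · exact pos x hx

/-- `signedPow s` as a permutation of the line. -/
noncomputable def signedPowEquiv (s : ℝ) (hs : s ≠ 0) : Equiv.Perm ℝ where
  toFun := signedPow s
  invFun := signedPow s⁻¹
  left_inv := signedPow_signedPow (mul_inv_cancel₀ hs)
  right_inv := signedPow_signedPow (inv_mul_cancel₀ hs)

theorem addRight_pow_apply (k : ℕ) (x : ℝ) : (Equiv.addRight (1 : ℝ) ^ k) x = x + k := by
  induction k with
  | zero => simp
  | succ k ih => rw [pow_succ', Equiv.Perm.mul_apply, ih]; simp [add_assoc]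

/-- Let a act as x ↦ m x and b as x ↦ x + 1, and let c be the unit translation conjugated by a
signed power T that turns multiplication by n into multiplication by m. -/
theorem not_commute_b_c {m n : ℕ} (hm : 2 ≤ m) (hn : 2 ≤ n) (hmn : m ≠ n) :
    ¬ Commute (b m n) (c m n) := by
  intro hcomm
  have hm0 : (0 : ℝ) < m := by positivity
  have hn0 : (0 : ℝ) < n := by positivity
  have hlm : 0 < Real.log m := Real.log_pos (by exact_mod_cast hm)
  have hln : 0 < Real.log n := Real.log_pos (by exact_mod_cast hn)
  set s := Real.log m / Real.log n with hs_def
  have hs : s ≠ 0 := (div_pos hlm hln).ne'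
  have hns : (n : ℝ) ^ s = m := by
    rw [Real.rpow_def_of_pos hn0, hs_def, mul_div_cancel₀ _ hln.ne', Real.exp_log hm0]
  let A : Equiv.Perm ℝ := Equiv.mulLeft₀ (m : ℝ) hm0.ne'
  let B : Equiv.Perm ℝ := Equiv.addRight 1
  let T := signedPowEquiv s hs
  let A' : Equiv.Perm ℝ := Equiv.mulLeft₀ (n : ℝ) hn0.ne'
  have hB : A * B = B ^ m * A := Equiv.ext fun x => by
    rw [Equiv.Perm.mul_apply, Equiv.Perm.mul_apply, addRight_pow_apply]
    simp [A, B, mul_add]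
  have hB' : A' * B = B ^ n * A' := Equiv.ext fun x => by
    rw [Equiv.Perm.mul_apply, Equiv.Perm.mul_apply, addRight_pow_apply]
    simp [A', B, mul_add]
  have hAT : A * T = T * A' := Equiv.ext fun x => by
    change (m : ℝ) * signedPow s x = signedPow s (n * x)
    rw [signedPow_mul s hn0, hns]
  have hC : A * (T * B * T⁻¹) = (T * B * T⁻¹) ^ n * A := by
    have h1 : T⁻¹ * A = A' * T⁻¹ := by
      rw [inv_mul_eq_iff_eq_mul, ← mul_assoc, ← hAT, mul_inv_cancel_right]
    rw [conj_pow, mul_assoc _ T⁻¹ A, h1, ← mul_assoc, ← mul_assoc, hAT, mul_assoc T A' B, hB']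
    simp only [mul_assoc]
  have h := hcomm.map (lift A B (T * B * T⁻¹) hB hC)
  have h' : Commute B (T * B * T⁻¹) := h
  -- At 0 the two products give 2 and 2ˢ, forcing s = 1 and hence m = n.
  have h0 := Equiv.congr_fun h'.eq 0
  have e0 : T⁻¹ 0 = 0 := signedPow_zero _
  have e1 : T⁻¹ 1 = 1 := (signedPow_of_pos _ one_pos).trans (Real.one_rpow _)
  have e2 : T 1 = 1 := (signedPow_of_pos _ one_pos).trans (Real.one_rpow _)
  have e3 : T 2 = 2 ^ s := signedPow_of_pos _ two_pos
  have hBx : ∀ x, B x = x + 1 := fun _ => rfl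
  simp only [Equiv.Perm.mul_apply, hBx, e0, zero_add, e1, e2] at h0
  rw [one_add_one_eq_two, e3] at h0
  have h2 : s = 1 := by
    have := congrArg Real.log h0
    rw [Real.log_rpow two_pos] at this
    exact mul_right_cancel₀ (Real.log_pos one_lt_two).ne' (by linarith)
  rw [h2, Real.rpow_one] at hns
  exact hmn (by exact_mod_cast hns.symm)

end BS2

theorem mainTheorem6 (m n : ℕ) (hm : 2 ≤ m) (hn : 2 ≤ n) (hmn : m ≠ n)
    (ρ : BS2 m n →* DiffOnePlus) :
    Disjoint
        (interior (homeoSupport (ρ (BS2.b m n) : Icc (0 : ℝ) 1 ≃ₜ Icc (0 : ℝ) 1)))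
        (interior (homeoSupport (ρ (BS2.c m n) : Icc (0 : ℝ) 1 ≃ₜ Icc (0 : ℝ) 1))) ∧
      Commute (ρ (BS2.b m n)) (ρ (BS2.c m n)) ∧
      ¬ Function.Injective ρ := by
  have hb : ρ (BS2.a m n) * ρ (BS2.b m n) = ρ (BS2.b m n) ^ m * ρ (BS2.a m n) := by
    rw [← map_mul, BS2.a_mul_b, map_mul, map_pow]
  have hc : ρ (BS2.a m n) * ρ (BS2.c m n) = ρ (BS2.c m n) ^ n * ρ (BS2.a m n) := by
    rw [← map_mul, BS2.a_mul_c, map_mul, map_pow]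
  have key := DiffOnePlus.smul_eq_or_smul_eq hm hn hmn hb hc
  have hcomm := DiffOnePlus.commute_of_smul_eq_or key
  refine ⟨?_, hcomm, fun hinj => BS2.not_commute_b_c hm hn hmn (hinj ?_)⟩
  · refine disjoint_interior_closure (DiffOnePlus.isClosed_fixed _).isOpen_compl ?_
    exact Set.disjoint_left.2 fun x h1 h2 => (key x).elim h1 h2
  · rw [map_mul, map_mul, hcomm.eq]
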